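/- **Setting.** Let $N\ge 2$, let $(x_i,y_i)_{i\le N}$ be training samples, $f_\theta$ a model, $\theta$ a fixed parameter, and $\ell_i=\ell(f_\theta(x_i),y_i)\in\mathbb R$. Let $G_N=(V,E,W)$ be a connected finite undirected loop-free graph on $V=\{1,\dots,N\}$ with symmetric weights $w_{ij}>0$ for $(i,j)\in E$ and $w_{ij}=0$ otherwise; sums over $(i,j)\in E$ count each edge in both orientations. Let $\mathscr P$ be the probability simplex in $\mathbb R^N$, $\mathscr P_o$ the set of its points with all coordinates positive, and $\hat P_X=(1/N,\dots,1/N)$. Let $\alpha\in\mathbb R$, $\beta>0$ and $$\mathcal R_N(q)=\sum_i q_i\ell_i-\frac{\alpha}{2}\sum_{(i,j)\in E}w_{ij}q_iq_j(\ell_i-\ell_j)^2-\beta\sum_i q_i\log q_i .$$ For $q\in\mathscr P$ and $v\in\mathbb R$ let $\kappa_{ij}(q,v)=q_j$ if $v>0$ and $q_i$ if $v\le 0$ (upwind density). For $p_0,p_1\in\mathscr P_o$ let $$\mathcal{GW}^2(p_0,p_1)=\inf_{(p,v)}\int_0^1\frac12\sum_{(i,j)\in E}\kappa_{ij}(p(t),v_{ij}(t))\,v_{ij}(t)^2\,dt\in[0,\infty],$$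 over curves $p:[0,1]\to\mathscr P_o$ with $p(0)=p_0$, $p(1)=p_1$ and measurable $v$ with $v_{ij}=-v_{ji}$, $v_{ij}=0$ for $(i,j)\notin E$, and $\dot p_i=\sum_{j:(i,j)\in E}\sqrt{w_{ij}}\,v_{ij}\,\kappa_{ij}(p,v_{ij})$ on $[0,1]$. Let $T_{in}>0$ and let $q:[0,T_{in}]\to\mathscr P_o$ be a solution, with $q(0)=\hat P_X$, of the gradient flow $$\dot q_i=\sum_{j:(i,j)\in E}w_{ij}\,v_{ij}\,\kappa_{ij}(q,v_{ij}),\qquad v_{ij}=\ell_i-\ell_j+\beta(\log q_j-\log q_i)+\alpha\Big(\sum_{h}(\ell_h-\ell_j)^2w_{jh}q_h-\sum_{h}(\ell_h-\ell_i)^2w_{ih}q_h\Big).$$ Put $q^{T_{in}}=q(T_{in})$, $\rho=\mathcal{GW}^2(\hat P_X,q^{T_{in}})$, and let $q^*$ be a maximizer of $\mathcal R_N$ over $\{q\in\mathscr P_o:\mathcal{GW}^2(\hat P_X,q)\le\rho\}$. **Constants.** Let $K_{ij}=\frac{\alpha}{2}w_{ij}(\ell_i-\ell_j)^2$ and $\nabla^2\mathcal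 R_N(q)=\beta\,\mathrm{diag}(1/q_1,\dots,1/q_N)+2K$ (the Hessian of $-\mathcal R_N$), and let $\lambda_{\min}(\nabla^2\mathcal R_N)$ be the infimum over $q\in\mathscr P_o$ of its smallest eigenvalue. Let $\hat L=\mathrm{diag}(\sum_jw_{ij})-W$ be the graph Laplacian, with second smallest eigenvalue $\lambda_{\rm sec}(\hat L)$ and largest eigenvalue $\lambda_{\max}(\hat L)$. Let $M=\max_{q\in\mathscr P,\,i,j}e^{V_i(q)-V_j(q)}$ with $V(q)=\ell-2Kq$, and $$m=\frac12\Big(\frac1{1+(2M)^{1/\beta}}\Big)^{N-2}\min\Big\{\frac1{1+(2M)^{1/\beta}},\frac1N\Big\}.$$ Let $k$ be the maximal number of neighbors of a vertex, let $H$ be the supremum over $\{q\in\mathscr P: q_i\ge m\ \forall i\}$ of the maximal absolute column sum of $\nabla^2\mathcal R_N(q)$, and let $$r=\sqrt2\,k\,\max_{(i,j)\in E}w_{ij}\;\frac{H}{\lambda_{\min}(\nabla^2\mathcal R_N)^{3/2}}\;\frac{1-m}{m^2}\;\frac{\lambda_{\max}(\hat L)}{\lambda_{\rm sec}(\hat L)^2}\sqrt{\max_{\mathscr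 P}\mathcal R_N-\mathcal R_N(\hat P_X)}$$ (with $r=0$ if $\lambda_{\min}(\nabla^2\mathcal R_N)\le0$). Finally let $$C=2m\,\lambda_{\rm sec}(\hat L)\,\lambda_{\min}(\nabla^2\mathcal R_N)\,\frac1{(r+1)^2}.$$ **Proposition 3.2 (Approximation Error Ratio).** Assume that $\mathcal R_N$ is concave on $\mathscr P$ and that $\hat P_X$ does not already maximize $\mathcal R_N$ over $\mathscr P$. Then $\mathcal R_N(q^*)-\mathcal R_N(\hat P_X)>0$ and $$\frac{\mathcal R_N(q^*)-\mathcal R_N(q^{T_{in}})}{\mathcal R_N(q^*)-\mathcal R_N(\hat P_X)}<e^{-C\,T_{in}}.$$ Moreover $C>0$ whenever $\lambda_{\min}(\nabla^2\mathcal R_N)>0$. -/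

import Mathlib

open scoped ENNReal

noncomputable section

namespace GCDRO

/-- A finite weighted undirected graph `G_N = (V, E, W)` without loops on the vertex set
`{1, …, N}` (one vertex per training sample): a simple graph with a symmetric weight that is
positive exactly on the edges. -/
structure WeightedGraph (N : ℕ) where
  graph : SimpleGraph (Fin N)
  weight : Fin N → Fin N → ℝ
  weight_symm : ∀ i j, weight i j = weight j i
  weight_pos : ∀ i j, graph.Adj i j → 0 < weight i j
  weight_zero : ∀ i j, ¬ graph.Adj i j → weight i j = 0

variable {N : ℕ}

/-- The interior `𝒫_o(G_N)` of the probability simplex `𝒫(G_N) = stdSimplex ℝ (Fin N)`. -/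
def interiorSimplex (N : ℕ) : Set (Fin N → ℝ) :=
  {p | p ∈ stdSimplex ℝ (Fin N) ∧ ∀ i, 0 < p i}

/-- The empirical distribution of the `N` training samples: mass `1 / N` at each vertex. -/
def empirical (N : ℕ) : Fin N → ℝ := fun _ => 1 / (N : ℝ)

/-! ### The discrete geometric Wasserstein distance -/

/-- Upwind density on the edge `(i, j)` for a velocity `v` (mass moves from `j` to `i` when
`v > 0`): the density at the vertex that the mass leaves. -/
def upwind (p : Fin N → ℝ) (i j : Fin N) (v : ℝ) : ℝ :=
  if 0 < v then p j else p i

/-- Velocity fields on `G`: antisymmetric arrays carried by the edges. -/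
def IsVelocityField (G : WeightedGraph N) (v : Fin N → Fin N → ℝ) : Prop :=
  (∀ i j, v i j = - v j i) ∧ ∀ i j, ¬ G.graph.Adj i j → v i j = 0

/-- The graph divergence of the flux `p v`. The weight vanishes off the edge set, so the sum is
over the `j` with `(i, j) ∈ E`. -/
def divergence (G : WeightedGraph N) (p : Fin N → ℝ) (v : Fin N → Fin N → ℝ) (i : Fin N) : ℝ :=
  - ∑ j, Real.sqrt (G.weight i j) * v i j * upwind p i j (v i j)

/-- Kinetic energy `½ ∑_{(i,j) ∈ E} ξ_{ij}(p) v_{ij}²`, each edge being counted in both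
orientations (`v` vanishes off the edge set). -/
def kineticEnergy (p : Fin N → ℝ) (v : Fin N → Fin N → ℝ) : ℝ :=
  (1 / 2) * ∑ i, ∑ j, upwind p i j (v i j) * v i j ^ 2

/-- `(p, v)` is a transport plan from `p₀` to `p₁` in `𝒫_o(G)`: the continuity equation
`dp/dt + div_G (p v) = 0` holds on `[0, 1]`. -/
structure IsPlan (G : WeightedGraph N) (p₀ p₁ : Fin N → ℝ)
    (p : ℝ → Fin N → ℝ) (v : ℝ → Fin N → Fin N → ℝ) : Prop where
  start : p 0 = p₀
  finish : p 1 = p₁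
  mem : ∀ t ∈ Set.Icc (0 : ℝ) 1, p t ∈ interiorSimplex N
  velocity : ∀ t ∈ Set.Icc (0 : ℝ) 1, IsVelocityField G (v t)
  measurable : Measurable v
  continuity_eq : ∀ t ∈ Set.Icc (0 : ℝ) 1, ∀ i,
    HasDerivWithinAt (fun s => p s i) (- divergence G (p t) (v t) i) (Set.Icc 0 1) t

/-- The squared discrete geometric Wasserstein distance, as an extended nonnegative number. -/
def gwSq (G : WeightedGraph N) (p₀ p₁ : Fin N → ℝ) : ℝ≥0∞ :=
  ⨅ (p : ℝ → Fin N → ℝ) (v : ℝ → Fin N → Fin N → ℝ) (_ : IsPlan G p₀ p₁ p v),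
    ∫⁻ t in Set.Icc (0 : ℝ) 1, ENNReal.ofReal (kineticEnergy (p t) (v t))

/-- The ball `{q ∈ 𝒫_o(G) : GW²(p₀, q) ≤ ρ}`. -/
def gwBall (G : WeightedGraph N) (p₀ : Fin N → ℝ) (ρ : ℝ≥0∞) : Set (Fin N → ℝ) :=
  {q | q ∈ interiorSimplex N ∧ gwSq G p₀ q ≤ ρ}

/-! ### The calibrated risk and its gradient flow -/

/-- The risk `R_N(q)` for the vector `l` of sample losses: mean loss, minus the graph total
variation of the losses (each edge counted in both orientations), minus the negative entropy. -/
def risk (G : WeightedGraph N) (α β : ℝ) (l : Fin N → ℝ) (q : Fin N → ℝ) : ℝ :=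
  ∑ i, q i * l i
    - α / 2 * ∑ i, ∑ j, G.weight i j * q i * q j * (l i - l j) ^ 2
    - β * ∑ i, q i * Real.log (q i)

/-- The difference along `(i, j)` of the first variation of the risk. -/
def drive (G : WeightedGraph N) (α β : ℝ) (l : Fin N → ℝ) (q : Fin N → ℝ) (i j : Fin N) : ℝ :=
  l i - l j + β * (Real.log (q j) - Real.log (q i))
    + α * (∑ h, (l h - l j) ^ 2 * G.weight j h * q h - ∑ h, (l h - l i) ^ 2 * G.weight i h * q h)

/-- `q` solves on `[0, T]`, inside `𝒫_o(G)` and from `q₀`, the gradient flow of the negative risk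
in the geometric Wasserstein space:
`dq_i/dt = ∑_{(i,j) ∈ E} w_{ij} v_{ij} (𝟙(v_{ij} > 0) q_j + 𝟙(v_{ij} ≤ 0) q_i)`
with `v_{ij}` the quantity `drive`. -/
structure IsGradientFlow (G : WeightedGraph N) (α β : ℝ) (l : Fin N → ℝ) (q₀ : Fin N → ℝ)
    (T : ℝ) (q : ℝ → Fin N → ℝ) : Prop where
  start : q 0 = q₀
  mem : ∀ t ∈ Set.Icc (0 : ℝ) T, q t ∈ interiorSimplex N
  flow : ∀ t ∈ Set.Icc (0 : ℝ) T, ∀ i,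
    HasDerivWithinAt (fun s => q s i)
      (∑ j, G.weight i j *
        (drive G α β l (q t) i j * upwind (q t) i j (drive G α β l (q t) i j)))
      (Set.Icc 0 T) t

/-! ### The constants in the rate -/

/-- The interaction matrix `K_{ij} = (α/2) w_{ij} (l_i - l_j)²`. -/
def interaction (G : WeightedGraph N) (α : ℝ) (l : Fin N → ℝ) : Matrix (Fin N) (Fin N) ℝ :=
  Matrix.of fun i j => α / 2 * G.weight i j * (l i - l j) ^ 2

/-- The Hessian `β diag(1/q_1, …, 1/q_N) + 2 K` of `-R_N` at `q` (for `q` in the interior). -/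
def hessian (G : WeightedGraph N) (α β : ℝ) (l : Fin N → ℝ) (q : Fin N → ℝ) :
    Matrix (Fin N) (Fin N) ℝ :=
  β • Matrix.diagonal (fun i => 1 / q i) + (2 : ℝ) • interaction G α l

/-- `λ_min(∇²R_N)`: the infimum over `q ∈ 𝒫_o(G)` of the smallest eigenvalue of the Hessian. -/
def lambdaMin (G : WeightedGraph N) (α β : ℝ) (l : Fin N → ℝ) : ℝ :=
  sInf {x | ∃ q ∈ interiorSimplex N, x ∈ spectrum ℝ (hessian G α β l q)}

/-- The graph Laplacian: weighted degrees on the diagonal, minus the weights. -/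
def laplacian (G : WeightedGraph N) : Matrix (Fin N) (Fin N) ℝ :=
  Matrix.diagonal (fun i => ∑ j, G.weight i j) - Matrix.of G.weight

theorem laplacian_isHermitian (G : WeightedGraph N) : (laplacian G).IsHermitian := by
  refine (Matrix.isHermitian_diagonal _).sub (Matrix.IsHermitian.ext fun i j => ?_)
  simp [G.weight_symm j i]

/-- The second smallest eigenvalue (with multiplicity) of the Laplacian;
`Matrix.IsHermitian.eigenvalues₀` lists the eigenvalues in decreasing order. -/
def lambdaSec (G : WeightedGraph N) (hN : 2 ≤ N) : ℝ :=
  (laplacian_isHermitian G).eigenvalues₀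
    ⟨N - 2, by rw [Fintype.card_fin]; omega⟩

/-- The largest eigenvalue of the Laplacian. -/
def lambdaMax (G : WeightedGraph N) (hN : 2 ≤ N) : ℝ :=
  (laplacian_isHermitian G).eigenvalues₀
    ⟨0, by rw [Fintype.card_fin]; omega⟩

/-- The first variation `l_i - 2 (K q)_i` of the risk without its entropy term. -/
def potential (G : WeightedGraph N) (α : ℝ) (l : Fin N → ℝ) (q : Fin N → ℝ) (i : Fin N) : ℝ :=
  l i - 2 * (interaction G α l).mulVec q i

/-- `M`: the maximum of `exp (V_i(q) - V_j(q))`, with `V` the quantity `potential`, over all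
distributions `q` and all pairs of vertices. -/
def boltzmannBound (G : WeightedGraph N) (α : ℝ) (l : Fin N → ℝ) : ℝ :=
  sSup {x | ∃ q ∈ stdSimplex ℝ (Fin N), ∃ i j,
    x = Real.exp (potential G α l q i - potential G α l q j)}

/-- The constant `m = ½ (1 / (1 + (2M)^{1/β}))^{N-2} min {1 / (1 + (2M)^{1/β}), 1 / N}`. -/
def mConst (G : WeightedGraph N) (α β : ℝ) (l : Fin N → ℝ) : ℝ :=
  1 / 2 * (1 / (1 + (2 * boltzmannBound G α l) ^ (1 / β))) ^ (N - 2)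
    * min (1 / (1 + (2 * boltzmannBound G α l) ^ (1 / β))) (1 / (N : ℝ))

/-- `‖Hess R_N‖₁`: the supremum of the maximal absolute column sum of the Hessian, over the
distributions all of whose masses are at least `m`. -/
def hessianNorm (G : WeightedGraph N) (α β : ℝ) (l : Fin N → ℝ) : ℝ :=
  sSup {x | ∃ q ∈ stdSimplex ℝ (Fin N), (∀ i, mConst G α β l ≤ q i) ∧
    ∃ j, x = ∑ i, |hessian G α β l q i j|}

open Classical in
/-- The largest number of neighbors of a vertex. -/
def maxNeighbors (G : WeightedGraph N) : ℕ := G.graph.maxDegree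

/-- The largest edge weight. -/
def maxWeight (G : WeightedGraph N) : ℝ := ⨆ e : Fin N × Fin N, G.weight e.1 e.2

/-- `R_N(q^∞)`: the largest value of the risk over all distributions. -/
def maxRisk (G : WeightedGraph N) (α β : ℝ) (l : Fin N → ℝ) : ℝ :=
  sSup (risk G α β l '' stdSimplex ℝ (Fin N))

/-- The constant `r`; only meaningful when `0 < λ_min(∇²R_N)`. -/
def rConst (G : WeightedGraph N) (hN : 2 ≤ N) (α β : ℝ) (l : Fin N → ℝ) : ℝ :=
  Real.sqrt 2 * maxNeighbors G * maxWeight G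
    * (hessianNorm G α β l / lambdaMin G α β l ^ (3 / 2 : ℝ))
    * ((1 - mConst G α β l) / mConst G α β l ^ 2)
    * (lambdaMax G hN / lambdaSec G hN ^ 2)
    * Real.sqrt (maxRisk G α β l - risk G α β l (empirical N))

/-- The rate `C = 2 m λ_sec(L̂) λ_min(∇²R_N) / (r + 1)²`. -/
def rate (G : WeightedGraph N) (hN : 2 ≤ N) (α β : ℝ) (l : Fin N → ℝ) : ℝ :=
  2 * mConst G α β l * lambdaSec G hN * lambdaMin G α β l
    * (1 / (rConst G hN α β l + 1) ^ 2)

end GCDRO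

end

/-! The flow is upwind gradient ascent of the risk, so with `g = riskGrad` the risk grows at rate `½
∑ w_ij κ_ij (g_i - g_j)²`. If all densities are at least `μ`, this is at least `μ` times the
Dirichlet energy of `g`, hence at least `μ λ_sec` times the sum of squared deviations of `g` from
its mean (Poincaré on a connected graph). When `λ_min > 0`, strong concavity bounds that sum below
by `2 λ_min` times the gap to any competitor. This is a Polyak–Łojasiewicz inequality
(`mul_gap_le_dissipation`), and Grönwall turns it into exponential decay of the gap at rate `2 μ
λ_sec λ_min` (`IsGradientFlow.gap_le`).

The uniform `μ` comes from a barrier argument (`IsGradientFlow.two_mul_mConst_le`). When a proper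
subset of vertices holds almost all the mass, the entropy term dominates the potential and pushes
mass out of the subset. Induction on the size of the subset bounds its mass away from 1; for
complements of single vertices this gives `μ = 2 m`. The resulting rate is `4 m λ_sec λ_min`, at
least twice `rate` because `r ≥ 0`, which makes the final inequality strict.

If `λ_min ≤ 0` the claimed rate is nonpositive, and it is enough that the ratio is below 1. That
follows from strict growth of the risk (`IsGradientFlow.risk_lt`): a stationary start would have
constant gradient, hence be a maximizer by concavity. The Wasserstein ball enters only through the
fact that `q T` belongs to it, so that `qstar` does at least as well as `q T`. -/

namespace GCDRO

/-! ### Spectral expansion of symmetric quadratic forms. -/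

section Spectral

variable {n : Type*} [Fintype n] [DecidableEq n] {A : Matrix n n ℝ}

theorem sum_eigenvectorBasis_dotProduct_mul (hA : A.IsHermitian) (x y : n → ℝ) :
    ∑ i, ((hA.eigenvectorBasis i).ofLp ⬝ᵥ x) * ((hA.eigenvectorBasis i).ofLp ⬝ᵥ y) = x ⬝ᵥ y := by
  have h := hA.eigenvectorBasis.sum_inner_mul_inner (WithLp.toLp 2 x) (WithLp.toLp 2 y)
  simp only [EuclideanSpace.inner_eq_star_dotProduct, star_trivial] at h
  rw [dotProduct_comm x y, ← h]
  exact Finset.sum_congr rfl fun i _ => by rw [dotProduct_comm y]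

theorem eigenvectorBasis_dotProduct_mulVec (hA : A.IsHermitian) (x : n → ℝ) (i : n) :
    (hA.eigenvectorBasis i).ofLp ⬝ᵥ A.mulVec x
      = hA.eigenvalues i * ((hA.eigenvectorBasis i).ofLp ⬝ᵥ x) := by
  have hT : A.transpose = A := hA
  rw [Matrix.dotProduct_mulVec, ← Matrix.mulVec_transpose, hT, hA.mulVec_eigenvectorBasis,
    smul_dotProduct, smul_eq_mul]

theorem dotProduct_mulVec_eq_sum_eigenvalues (hA : A.IsHermitian) (x : n → ℝ) :
    x ⬝ᵥ A.mulVec x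
      = ∑ i, hA.eigenvalues i * ((hA.eigenvectorBasis i).ofLp ⬝ᵥ x) ^ 2 := by
  rw [← sum_eigenvectorBasis_dotProduct_mul hA]
  refine Finset.sum_congr rfl fun i _ => ?_
  rw [eigenvectorBasis_dotProduct_mulVec]
  ring

/-- A lower bound for the spectrum is a lower bound for the quadratic form. -/
theorem mul_dotProduct_self_le_of_le_spectrum (hA : A.IsHermitian) {c : ℝ}
    (hc : ∀ x ∈ spectrum ℝ A, c ≤ x) (x : n → ℝ) : c * (x ⬝ᵥ x) ≤ x ⬝ᵥ A.mulVec x := by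
  rw [dotProduct_mulVec_eq_sum_eigenvalues hA, ← sum_eigenvectorBasis_dotProduct_mul hA,
    Finset.mul_sum]
  refine Finset.sum_le_sum fun i _ => ?_
  rw [← pow_two]
  exact mul_le_mul_of_nonneg_right (hc _ (hA.eigenvalues_mem_spectrum_real i)) (sq_nonneg _)

end Spectral

variable {N : ℕ}

/-! ### Graph Laplacian, spectral gap and Poincaré inequality. -/

theorem WeightedGraph.weight_nonneg (G : WeightedGraph N) (i j : Fin N) : 0 ≤ G.weight i j := by
  by_cases h : G.graph.Adj i j
  · exact (G.weight_pos i j h).le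
  · exact (G.weight_zero i j h).ge

theorem laplacian_mulVec (G : WeightedGraph N) (x : Fin N → ℝ) (i : Fin N) :
    (laplacian G).mulVec x i = ∑ j, G.weight i j * (x i - x j) := by
  rw [laplacian, Matrix.sub_mulVec, Pi.sub_apply, Matrix.mulVec_diagonal, Finset.sum_mul]
  simp only [Matrix.mulVec, dotProduct, Matrix.of_apply]
  rw [← Finset.sum_sub_distrib]
  exact Finset.sum_congr rfl fun j _ => by ring

/-- The Dirichlet form of the graph. -/
theorem dotProduct_laplacian_mulVec (G : WeightedGraph N) (x : Fin N → ℝ) :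
    x ⬝ᵥ (laplacian G).mulVec x = 1 / 2 * ∑ i, ∑ j, G.weight i j * (x i - x j) ^ 2 := by
  have h1 : x ⬝ᵥ (laplacian G).mulVec x = ∑ i, ∑ j, G.weight i j * (x i - x j) * x i := by
    simp only [dotProduct, laplacian_mulVec, Finset.mul_sum]
    exact Finset.sum_congr rfl fun i _ => Finset.sum_congr rfl fun j _ => by ring
  have h2 : x ⬝ᵥ (laplacian G).mulVec x = ∑ i, ∑ j, G.weight i j * (x j - x i) * x j := by
    rw [h1, Finset.sum_comm]
    exact Finset.sum_congr rfl fun i _ => Finset.sum_congr rfl fun j _ => by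
      rw [G.weight_symm j i]
  have h3 : x ⬝ᵥ (laplacian G).mulVec x + x ⬝ᵥ (laplacian G).mulVec x
      = ∑ i, ∑ j, G.weight i j * (x i - x j) ^ 2 := by
    nth_rewrite 1 [h1]
    rw [h2, ← Finset.sum_add_distrib]
    refine Finset.sum_congr rfl fun i _ => ?_
    rw [← Finset.sum_add_distrib]
    exact Finset.sum_congr rfl fun j _ => by ring
  linarith

theorem eq_of_forall_adj {G : WeightedGraph N} (hG : G.graph.Connected) {x : Fin N → ℝ}
    (h : ∀ i j, G.graph.Adj i j → x i = x j) (i j : Fin N) : x i = x j := by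
  obtain ⟨p⟩ := hG.preconnected i j
  induction p with
  | nil => rfl
  | cons hadj _ ih => exact (h _ _ hadj).trans ih

/-- On a connected graph a function with nonpositive Dirichlet energy is constant. -/
theorem eq_of_dotProduct_laplacian_nonpos {G : WeightedGraph N} (hG : G.graph.Connected)
    {x : Fin N → ℝ} (h : x ⬝ᵥ (laplacian G).mulVec x ≤ 0) (i j : Fin N) : x i = x j := by
  refine eq_of_forall_adj hG (fun a b hab => ?_) i j
  by_contra hne
  rw [dotProduct_laplacian_mulVec] at h
  have hnn : ∀ i j, 0 ≤ G.weight i j * (x i - x j) ^ 2 := fun i j =>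
    mul_nonneg (G.weight_nonneg i j) (sq_nonneg _)
  have h1 : G.weight a b * (x a - x b) ^ 2 ≤ ∑ j, G.weight a j * (x a - x j) ^ 2 :=
    Finset.single_le_sum (f := fun j => G.weight a j * (x a - x j) ^ 2)
      (fun j _ => hnn a j) (Finset.mem_univ b)
  have h2 : ∑ j, G.weight a j * (x a - x j) ^ 2 ≤ ∑ i, ∑ j, G.weight i j * (x i - x j) ^ 2 :=
    Finset.single_le_sum (f := fun i => ∑ j, G.weight i j * (x i - x j) ^ 2)
      (fun i _ => Finset.sum_nonneg fun j _ => hnn i j) (Finset.mem_univ a)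
  have h3 : 0 < G.weight a b * (x a - x b) ^ 2 :=
    mul_pos (G.weight_pos a b hab) (sq_pos_of_ne_zero (sub_ne_zero.2 hne))
  linarith

theorem dotProduct_laplacian_eigenvector (G : WeightedGraph N) (i : Fin N) :
    ((laplacian_isHermitian G).eigenvectorBasis i).ofLp ⬝ᵥ
      (laplacian G).mulVec ((laplacian_isHermitian G).eigenvectorBasis i).ofLp
      = (laplacian_isHermitian G).eigenvalues i := by
  have h := (laplacian_isHermitian G).eigenvectorBasis.orthonormal.1 i
  rw [(laplacian_isHermitian G).mulVec_eigenvectorBasis, dotProduct_smul, smul_eq_mul]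
  have h1 : inner ℝ ((laplacian_isHermitian G).eigenvectorBasis i)
    ((laplacian_isHermitian G).eigenvectorBasis i) = (1 : ℝ) := by
    rw [real_inner_self_eq_norm_sq, h, one_pow]
  rw [EuclideanSpace.inner_eq_star_dotProduct, star_trivial] at h1
  rw [h1, mul_one]

theorem laplacian_eigenvalues_nonneg (G : WeightedGraph N) (i : Fin N) :
    0 ≤ (laplacian_isHermitian G).eigenvalues i := by
  rw [← dotProduct_laplacian_eigenvector, dotProduct_laplacian_mulVec]
  exact mul_nonneg (by norm_num) (Finset.sum_nonneg fun i _ => Finset.sum_nonneg fun j _ =>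
    mul_nonneg (G.weight_nonneg i j) (sq_nonneg _))

/-- On a connected graph at most one eigenvalue (with multiplicity) of the Laplacian vanishes. -/
theorem laplacian_eigenvalues_pos_or {G : WeightedGraph N} (hG : G.graph.Connected)
    {i j : Fin N} (hij : i ≠ j) : 0 < (laplacian_isHermitian G).eigenvalues i ∨
      0 < (laplacian_isHermitian G).eigenvalues j := by
  by_contra! h
  set b := (laplacian_isHermitian G).eigenvectorBasis
  have hi := eq_of_dotProduct_laplacian_nonpos hG
    ((dotProduct_laplacian_eigenvector G i).trans_le h.1)
  have hj := eq_of_dotProduct_laplacian_nonpos hG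
    ((dotProduct_laplacian_eigenvector G j).trans_le h.2)
  have horth : inner ℝ (b i) (b j) = (0 : ℝ) := b.orthonormal.2 hij
  have hii := b.orthonormal.1 i
  have hjj := b.orthonormal.1 j
  -- Both eigenvectors are constant, hence proportional, which contradicts orthonormality. The index
  -- `i` also serves as an arbitrary vertex at which to read off the constants.
  have hdep : (b j) i • b i = (b i) i • b j := by
    ext k
    simp only [PiLp.smul_apply, smul_eq_mul]
    rw [show (b i) k = (b i) i from hi k i, show (b j) k = (b j) i from hj k i, mul_comm]
  have h1 : (b j) i = 0 := by
    have := congrArg (fun z => inner ℝ (b i) z) hdep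
    simp only [inner_smul_right, horth, real_inner_self_eq_norm_sq, hii] at this
    simpa using this
  have h2 : b j = 0 := by
    ext k
    exact (hj k i).trans h1
  rw [h2, norm_zero] at hjj
  exact zero_ne_one hjj

/-- Translates the sorted list `eigenvalues₀` into the vertex-indexed `eigenvalues`: `z` carries the
last entry (position `N - 1`) and `s` the one before it. -/
theorem exists_laplacian_eigenvalues_eq_lambdaSec (G : WeightedGraph N) (hN : 2 ≤ N) :
    ∃ z s : Fin N, z ≠ s ∧ (laplacian_isHermitian G).eigenvalues s = lambdaSec G hN ∧
      (laplacian_isHermitian G).eigenvalues z ≤ lambdaSec G hN ∧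
      ∀ i, i ≠ z → lambdaSec G hN ≤ (laplacian_isHermitian G).eigenvalues i := by
  have hanti := (laplacian_isHermitian G).eigenvalues₀_antitone
  set e : Fin (Fintype.card (Fin N)) ≃ Fin N := Fintype.equivOfCardEq (Fintype.card_fin _)
  have he : ∀ i, (laplacian_isHermitian G).eigenvalues i
    = (laplacian_isHermitian G).eigenvalues₀ (e.symm i) := fun i => rfl
  have hcard : Fintype.card (Fin N) = N := Fintype.card_fin N
  refine ⟨e ⟨N - 1, by omega⟩, e ⟨N - 2, by omega⟩, ?_, ?_, ?_, ?_⟩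
  · rw [Ne, e.apply_eq_iff_eq, Fin.mk.injEq]
    omega
  · rw [he, e.symm_apply_apply]
    rfl
  · rw [he, e.symm_apply_apply]
    exact hanti (Fin.mk_le_mk.2 (by omega))
  · intro i hi
    rw [he]
    refine hanti (Fin.le_def.2 ?_)
    have h1 : e.symm i ≠ ⟨N - 1, by omega⟩ := fun h => hi (by rw [← h, e.apply_symm_apply])
    have h2 : (e.symm i : ℕ) ≠ N - 1 := fun h => h1 (Fin.ext h)
    have h3 := (e.symm i).isLt
    simp only
    omega

theorem lambdaSec_pos {G : WeightedGraph N} (hG : G.graph.Connected) (hN : 2 ≤ N) :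
    0 < lambdaSec G hN := by
  obtain ⟨z, s, hzs, hs, hz, -⟩ := exists_laplacian_eigenvalues_eq_lambdaSec G hN
  rcases laplacian_eigenvalues_pos_or hG hzs with h | h <;> linarith

theorem lambdaSec_le_lambdaMax (G : WeightedGraph N) (hN : 2 ≤ N) :
    lambdaSec G hN ≤ lambdaMax G hN :=
  (laplacian_isHermitian G).eigenvalues₀_antitone (Fin.mk_le_mk.2 (Nat.zero_le _))

/-- Poincaré inequality for functions of mean zero. -/
theorem lambdaSec_mul_le {G : WeightedGraph N} (hG : G.graph.Connected) (hN : 2 ≤ N)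
    {x : Fin N → ℝ} (hx : ∑ i, x i = 0) :
    lambdaSec G hN * (x ⬝ᵥ x) ≤ x ⬝ᵥ (laplacian G).mulVec x := by
  obtain ⟨z, s, hzs, hs, hz, hi⟩ := exists_laplacian_eigenvalues_eq_lambdaSec G hN
  rw [dotProduct_mulVec_eq_sum_eigenvalues (laplacian_isHermitian G),
    ← sum_eigenvectorBasis_dotProduct_mul (laplacian_isHermitian G), Finset.mul_sum]
  have h1 : (laplacian G).mulVec (fun _ => (1 : ℝ)) = 0 := by
    ext i
    rw [laplacian_mulVec]
    simp
  refine Finset.sum_le_sum fun i _ => ?_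
  rw [← pow_two]
  rcases eq_or_ne i z with rfl | hne
  · rcases (laplacian_eigenvalues_nonneg G i).eq_or_lt with h0 | h0
    · have hc := eq_of_dotProduct_laplacian_nonpos hG
        ((dotProduct_laplacian_eigenvector G i).trans_le h0.ge)
      have : ((laplacian_isHermitian G).eigenvectorBasis i).ofLp ⬝ᵥ x = 0 := by
        simp only [dotProduct]
        rw [Finset.sum_congr rfl fun j _ => by rw [hc j i], ← Finset.mul_sum, hx, mul_zero]
      simp [this]
    -- Were the smallest eigenvalue positive, all would be; the constant function lies in the
    -- kernel, so it would be orthogonal to the whole eigenbasis and vanish.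
    · exfalso
      have hpos : ∀ j, 0 < (laplacian_isHermitian G).eigenvalues j := fun j => by
        rcases eq_or_ne j i with rfl | hj
        · exact h0
        · exact (lambdaSec_pos hG hN).trans_le (hi j hj)
      have hb : ∀ j,
          ((laplacian_isHermitian G).eigenvectorBasis j).ofLp ⬝ᵥ (fun _ => (1 : ℝ)) = 0 := by
        intro j
        have := eigenvectorBasis_dotProduct_mulVec (laplacian_isHermitian G) (fun _ => (1 : ℝ)) j
        rw [h1, dotProduct_zero] at this
        exact (mul_eq_zero.1 this.symm).resolve_left (hpos j).ne'
      have := sum_eigenvectorBasis_dotProduct_mul (laplacian_isHermitian G)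
        (fun _ => (1 : ℝ)) (fun _ => (1 : ℝ))
      simp only [hb, mul_zero, Finset.sum_const_zero] at this
      simp only [dotProduct, mul_one, Finset.sum_const, Finset.card_univ, Fintype.card_fin,
        nsmul_eq_mul] at this
      have : N = 0 := by exact_mod_cast this.symm
      omega
  · exact mul_le_mul_of_nonneg_right (hi i hne) (sq_nonneg _)

/-! ### First and second derivatives of the risk. -/

/-- The gradient of the risk. -/
noncomputable def riskGrad (G : WeightedGraph N) (α β : ℝ) (l q : Fin N → ℝ) (i : Fin N) : ℝ :=
  potential G α l q i - β * (Real.log (q i) + 1)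

theorem interaction_isSymm (G : WeightedGraph N) (α : ℝ) (l : Fin N → ℝ) :
    (interaction G α l).transpose = interaction G α l := by
  ext i j
  simp only [interaction, Matrix.transpose_apply, Matrix.of_apply, G.weight_symm j i]
  ring

theorem dotProduct_interaction_comm (G : WeightedGraph N) (α : ℝ) (l x y : Fin N → ℝ) :
    x ⬝ᵥ (interaction G α l).mulVec y = y ⬝ᵥ (interaction G α l).mulVec x := by
  rw [Matrix.dotProduct_mulVec, ← Matrix.mulVec_transpose, interaction_isSymm, dotProduct_comm]

theorem two_mul_interaction_mulVec (G : WeightedGraph N) (α : ℝ) (l q : Fin N → ℝ) (i : Fin N) :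
    2 * (interaction G α l).mulVec q i = α * ∑ h, (l h - l i) ^ 2 * G.weight i h * q h := by
  simp only [interaction, Matrix.mulVec, dotProduct, Matrix.of_apply, Finset.mul_sum]
  exact Finset.sum_congr rfl fun j _ => by ring

/-- The velocity is a discrete gradient: the constant `β` in `riskGrad` cancels in the difference.
-/
theorem drive_eq (G : WeightedGraph N) (α β : ℝ) (l q : Fin N → ℝ) (i j : Fin N) :
    drive G α β l q i j = riskGrad G α β l q i - riskGrad G α β l q j := by
  simp only [drive, riskGrad, potential, two_mul_interaction_mulVec]
  ring

theorem risk_eq (G : WeightedGraph N) (α β : ℝ) (l q : Fin N → ℝ) :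
    risk G α β l q = ∑ i, (q i * l i - q i * (interaction G α l).mulVec q i
      - β * (q i * Real.log (q i))) := by
  rw [risk, Finset.sum_sub_distrib, Finset.sum_sub_distrib, ← Finset.mul_sum]
  congr 2
  simp only [interaction, Matrix.mulVec, dotProduct, Matrix.of_apply, Finset.mul_sum]
  exact Finset.sum_congr rfl fun i _ => Finset.sum_congr rfl fun j _ => by ring

theorem continuous_mulVec_apply (A : Matrix (Fin N) (Fin N) ℝ) (i : Fin N) :
    Continuous fun q : Fin N → ℝ => A.mulVec q i := by
  simp only [Matrix.mulVec, dotProduct]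
  fun_prop

theorem continuous_risk (G : WeightedGraph N) (α β : ℝ) (l : Fin N → ℝ) :
    Continuous (risk G α β l) := by
  rw [show risk G α β l = _ from funext (risk_eq G α β l)]
  refine continuous_finsetSum _ fun i _ => ?_
  have h1 := continuous_mulVec_apply (interaction G α l) i
  have h2 : Continuous fun q : Fin N → ℝ => q i * Real.log (q i) :=
    Real.continuous_mul_log.comp (continuous_apply i)
  fun_prop

theorem continuous_potential (G : WeightedGraph N) (α : ℝ) (l : Fin N → ℝ) (i : Fin N) :
    Continuous fun q => potential G α l q i := by
  have h1 := continuous_mulVec_apply (interaction G α l) i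
  unfold potential
  fun_prop

theorem HasDerivWithinAt.mulVec_apply {A : Matrix (Fin N) (Fin N) ℝ} {c : ℝ → Fin N → ℝ}
    {d : Fin N → ℝ} {S : Set ℝ} {t : ℝ}
    (hc : ∀ i, HasDerivWithinAt (fun s => c s i) (d i) S t) (i : Fin N) :
    HasDerivWithinAt (fun s => A.mulVec (c s) i) (A.mulVec d i) S t := by
  simp only [Matrix.mulVec, dotProduct]
  exact HasDerivWithinAt.fun_sum fun j _ => (hc j).const_mul _

/-- Chain rule for the risk along a curve of positive densities. -/
theorem hasDerivWithinAt_risk (G : WeightedGraph N) (α β : ℝ) (l : Fin N → ℝ)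
    {c : ℝ → Fin N → ℝ} {d : Fin N → ℝ} {S : Set ℝ} {t : ℝ}
    (hc : ∀ i, HasDerivWithinAt (fun s => c s i) (d i) S t) (hpos : ∀ i, 0 < c t i) :
    HasDerivWithinAt (fun s => risk G α β l (c s)) (∑ i, riskGrad G α β l (c t) i * d i) S t := by
  simp only [risk_eq]
  have h := HasDerivWithinAt.fun_sum (u := Finset.univ) fun i _ =>
    (((hc i).mul_const (l i)).fun_sub ((hc i).fun_mul
      (HasDerivWithinAt.mulVec_apply (A := interaction G α l) hc i))).fun_sub
      (((Real.hasDerivAt_mul_log (hpos i).ne').comp_hasDerivWithinAt t (hc i)).const_mul β)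
  refine h.congr_deriv ?_
  have hs := dotProduct_interaction_comm G α l (c t) d
  simp only [dotProduct] at hs
  simp only [riskGrad, potential, Finset.sum_sub_distrib, Finset.sum_add_distrib, hs, sub_mul]
  simp only [← Finset.sum_sub_distrib, ← Finset.sum_add_distrib]
  exact Finset.sum_congr rfl fun i _ => by ring

theorem hasDerivWithinAt_riskGrad (G : WeightedGraph N) (α β : ℝ) (l : Fin N → ℝ)
    {c : ℝ → Fin N → ℝ} {d : Fin N → ℝ} {S : Set ℝ} {t : ℝ}
    (hc : ∀ i, HasDerivWithinAt (fun s => c s i) (d i) S t) (hpos : ∀ i, 0 < c t i) (i : Fin N) :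
    HasDerivWithinAt (fun s => riskGrad G α β l (c s) i)
      (- (hessian G α β l (c t)).mulVec d i) S t := by
  unfold riskGrad potential
  have h := (((HasDerivWithinAt.mulVec_apply (A := interaction G α l) hc i).const_mul 2).const_sub
    (l i)).fun_sub ((((Real.hasDerivAt_log (hpos i).ne').comp_hasDerivWithinAt t (hc i)).add_const
      1).const_mul β)
  refine h.congr_deriv ?_
  rw [hessian, Matrix.add_mulVec, Matrix.smul_mulVec, Matrix.smul_mulVec, Pi.add_apply,
    Pi.smul_apply, Pi.smul_apply, Matrix.mulVec_diagonal]
  simp only [smul_eq_mul, one_div]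
  ring

theorem hessian_isHermitian (G : WeightedGraph N) (α β : ℝ) (l q : Fin N → ℝ) :
    (hessian G α β l q).IsHermitian := by
  refine Matrix.IsHermitian.ext fun i j => ?_
  have h1 := congrFun (congrFun (interaction_isSymm G α l) i) j
  rw [Matrix.transpose_apply] at h1
  have h2 : Matrix.diagonal (fun i => 1 / q i) j i = Matrix.diagonal (fun i => 1 / q i) i j := by
    rcases eq_or_ne i j with rfl | h
    · rfl
    · rw [Matrix.diagonal_apply_ne _ h, Matrix.diagonal_apply_ne _ h.symm]
  simp only [hessian, Matrix.add_apply, Matrix.smul_apply, star_trivial, h1, h2]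

theorem lambdaMin_mul_le {G : WeightedGraph N} {α β : ℝ} {l : Fin N → ℝ}
    (hpos : 0 < lambdaMin G α β l) {q : Fin N → ℝ} (hq : q ∈ interiorSimplex N) (x : Fin N → ℝ) :
    lambdaMin G α β l * (x ⬝ᵥ x) ≤ x ⬝ᵥ (hessian G α β l q).mulVec x := by
  refine mul_dotProduct_self_le_of_le_spectrum (hessian_isHermitian G α β l q) (fun e he => ?_) x
  refine csInf_le ?_ ⟨q, hq, he⟩
  -- `sInf` of a set unbounded below is 0 by convention, so positivity of `lambdaMin` already forces
  -- boundedness.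
  by_contra h
  rw [lambdaMin, Real.sInf_of_not_bddBelow h] at hpos
  exact lt_irrefl _ hpos

/-! ### Concavity inequalities along segments. -/

theorem hasDerivWithinAt_segment (q d : Fin N → ℝ) (S : Set ℝ) (t : ℝ) (i : Fin N) :
    HasDerivWithinAt (fun s : ℝ => (q + s • d) i) (d i) S t := by
  simpa using ((hasDerivWithinAt_id t S).mul_const (d i)).const_add (q i)

theorem segment_mem_interiorSimplex {q p : Fin N → ℝ} (hq : q ∈ interiorSimplex N)
    (hp : p ∈ stdSimplex ℝ (Fin N)) {s : ℝ} (h0 : 0 ≤ s) (h1 : s < 1) :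
    q + s • (p - q) ∈ interiorSimplex N := by
  have e : ∀ i, (q + s • (p - q)) i = (1 - s) * q i + s * p i := fun i => by
    simp only [Pi.add_apply, Pi.smul_apply, Pi.sub_apply, smul_eq_mul]
    ring
  have hpos : ∀ i, 0 < (q + s • (p - q)) i := fun i => by
    rw [e]
    exact add_pos_of_pos_of_nonneg (mul_pos (sub_pos.2 h1) (hq.2 i)) (mul_nonneg h0 (hp.1 i))
  refine ⟨⟨fun i => (hpos i).le, ?_⟩, hpos⟩
  simp only [e, Finset.sum_add_distrib, ← Finset.mul_sum, hq.1.2, hp.2]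
  ring

/-- A differentiable concave function on `[0, 1]` lies below its tangent at `0`. -/
theorem _root_.ConcaveOn.le_add_deriv_zero {f : ℝ → ℝ} {f' : ℝ}
    (hf : ConcaveOn ℝ (Set.Icc 0 1) f) (h : HasDerivWithinAt f f' (Set.Icc 0 1) 0) :
    f 1 ≤ f 0 + f' := by
  have := hf.slope_le_of_hasDerivWithinAt (x := 0) (y := 1) (by simp) (by simp) zero_lt_one h
  rw [slope_def_field] at this
  linarith

/-- First order condition for a concave risk. -/
theorem risk_le_of_concaveOn {G : WeightedGraph N} {α β : ℝ} {l : Fin N → ℝ}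
    (hconc : ConcaveOn ℝ (stdSimplex ℝ (Fin N)) (risk G α β l)) {q p : Fin N → ℝ}
    (hq : q ∈ interiorSimplex N) (hp : p ∈ stdSimplex ℝ (Fin N)) :
    risk G α β l p ≤ risk G α β l q + ∑ i, riskGrad G α β l q i * (p i - q i) := by
  have hline : ConcaveOn ℝ (Set.Icc 0 1) (fun s : ℝ => risk G α β l (q + s • (p - q))) := by
    have h := hconc.comp_affineMap (AffineMap.lineMap (k := ℝ) q p)
    have e : risk G α β l ∘ (AffineMap.lineMap (k := ℝ) q p)
        = fun s : ℝ => risk G α β l (q + s • (p - q)) := by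
      funext s
      simp [AffineMap.lineMap_apply, add_comm]
    rw [e] at h
    refine h.subset (fun s hs => ?_) (convex_Icc 0 1)
    exact (convex_stdSimplex ℝ (Fin N)).lineMap_mem hq.1 hp hs
  have hd := hasDerivWithinAt_risk G α β l (c := fun s : ℝ => q + s • (p - q)) (d := p - q)
    (S := Set.Icc 0 1) (t := 0) (hasDerivWithinAt_segment q (p - q) _ _)
    (fun i => by simpa using hq.2 i)
  simpa using hline.le_add_deriv_zero hd

/-- Strong concavity of the risk, with the modulus `lambdaMin`. -/
theorem risk_le_of_lambdaMin_pos {G : WeightedGraph N} {α β : ℝ} {l : Fin N → ℝ}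
    (hpos : 0 < lambdaMin G α β l) {q p : Fin N → ℝ}
    (hq : q ∈ interiorSimplex N) (hp : p ∈ stdSimplex ℝ (Fin N)) :
    risk G α β l p ≤ risk G α β l q + ∑ i, riskGrad G α β l q i * (p i - q i)
      - lambdaMin G α β l / 2 * ((p - q) ⬝ᵥ (p - q)) := by
  set c : ℝ → Fin N → ℝ := fun s => q + s • (p - q) with hc
  -- Adding `b s²` uses up exactly the curvature guaranteed by `lambdaMin`: the corrected function
  -- on the segment remains concave.
  set b := lambdaMin G α β l / 2 * ((p - q) ⬝ᵥ (p - q)) with hb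
  have hcd : ∀ S t i, HasDerivWithinAt (fun s => c s i) ((p - q) i) S t :=
    hasDerivWithinAt_segment q (p - q)
  have hccont : Continuous c := by
    rw [hc]
    fun_prop
  -- The endpoint `t = 1` is excluded because `p` may lie on the boundary of the simplex, where the
  -- logarithm is singular; continuity of the risk suffices there.
  have hd1 : ∀ S : Set ℝ, ∀ t, 0 ≤ t → t < 1 →
      HasDerivWithinAt (fun s => risk G α β l (c s) + b * s ^ 2)
        (∑ i, riskGrad G α β l (c t) i * (p - q) i + b * (2 * t)) S t := by
    intro S t h0 h1
    refine (hasDerivWithinAt_risk G α β l (hcd S t)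
      (segment_mem_interiorSimplex hq hp h0 h1).2).fun_add ?_
    simpa using (((hasDerivWithinAt_id t S).fun_pow 2).const_mul b)
  have hconc : ConcaveOn ℝ (Set.Icc 0 1) (fun s => risk G α β l (c s) + b * s ^ 2) := by
    refine concaveOn_of_hasDerivWithinAt2_nonpos (convex_Icc 0 1)
      (f' := fun t => ∑ i, riskGrad G α β l (c t) i * (p - q) i + b * (2 * t))
      (f'' := fun t => ∑ i, - (hessian G α β l (c t)).mulVec (p - q) i * (p - q) i + b * 2)
      ?_ ?_ ?_ ?_
    · have := (continuous_risk G α β l).comp hccont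
      simp only [Function.comp_def] at this
      fun_prop
    · intro t ht
      rw [interior_Icc] at ht ⊢
      exact hd1 _ t ht.1.le ht.2
    · intro t ht
      rw [interior_Icc] at ht ⊢
      refine HasDerivWithinAt.fun_add (HasDerivWithinAt.fun_sum fun i _ =>
        (hasDerivWithinAt_riskGrad G α β l (hcd _ t)
          (segment_mem_interiorSimplex hq hp ht.1.le ht.2).2 i).mul_const _) ?_
      simpa using (((hasDerivWithinAt_id t (Set.Ioo 0 1)).const_mul 2).const_mul b)
    · intro t ht
      rw [interior_Icc] at ht
      have := lambdaMin_mul_le hpos (segment_mem_interiorSimplex hq hp ht.1.le ht.2) (p - q)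
      have e : ∑ i, - (hessian G α β l (c t)).mulVec (p - q) i * (p - q) i
          = - ((p - q) ⬝ᵥ (hessian G α β l (c t)).mulVec (p - q)) := by
        rw [dotProduct, ← Finset.sum_neg_distrib]
        exact Finset.sum_congr rfl fun i _ => by ring
      rw [e, hb]
      linarith
  have h := hconc.le_add_deriv_zero (hd1 _ 0 le_rfl zero_lt_one)
  simp [hc] at h
  simp at hb
  linarith

/-- The suboptimality gap of a strongly concave risk is controlled by the variance of its
gradient. -/
theorem risk_sub_le_variance {G : WeightedGraph N} {α β : ℝ} {l : Fin N → ℝ}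
    (hpos : 0 < lambdaMin G α β l) {q p : Fin N → ℝ}
    (hq : q ∈ interiorSimplex N) (hp : p ∈ stdSimplex ℝ (Fin N)) (a : ℝ) :
    2 * lambdaMin G α β l * (risk G α β l p - risk G α β l q)
      ≤ ∑ i, (riskGrad G α β l q i - a) ^ 2 := by
  have h := risk_le_of_lambdaMin_pos hpos hq hp
  have h0 : ∑ i, (p i - q i) = 0 := by
    rw [Finset.sum_sub_distrib, hp.2, hq.1.2, sub_self]
  -- Completing the square. The shift `a` costs nothing since `p - q` has total mass zero.
  have h1 : ∀ i, 2 * lambdaMin G α β l * (riskGrad G α β l q i * (p i - q i))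
      - 2 * lambdaMin G α β l * (a * (p i - q i))
      - lambdaMin G α β l ^ 2 * ((p i - q i) * (p i - q i))
      ≤ (riskGrad G α β l q i - a) ^ 2 := fun i => by
    nlinarith [sq_nonneg (riskGrad G α β l q i - a - lambdaMin G α β l * (p i - q i))]
  have h2 := Finset.sum_le_sum fun i (_ : i ∈ Finset.univ) => h1 i
  rw [Finset.sum_sub_distrib, Finset.sum_sub_distrib, ← Finset.mul_sum, ← Finset.mul_sum,
    ← Finset.mul_sum, ← Finset.mul_sum, h0] at h2
  simp only [dotProduct, Pi.sub_apply] at h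
  have h3 := mul_le_mul_of_nonneg_left h (by positivity : 0 ≤ 2 * lambdaMin G α β l)
  linarith

/-! ### Upwind flux and dissipation. -/

/-- The mass that the gradient flow moves from `j` to `i` per unit of time. -/
noncomputable def flowFlux (G : WeightedGraph N) (α β : ℝ) (l q : Fin N → ℝ) (i j : Fin N) : ℝ :=
  G.weight i j * (drive G α β l q i j * upwind q i j (drive G α β l q i j))

/-- Reversing an edge leaves the upwind vertex unchanged, except at zero drive, where the flux
vanishes anyway. -/
theorem flowFlux_antisymm (G : WeightedGraph N) (α β : ℝ) (l q : Fin N → ℝ) (i j : Fin N) :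
    flowFlux G α β l q i j = - flowFlux G α β l q j i := by
  have h : drive G α β l q j i = - drive G α β l q i j := by
    rw [drive_eq, drive_eq]
    ring
  simp only [flowFlux, h, upwind, G.weight_symm j i]
  rcases lt_trichotomy (drive G α β l q i j) 0 with h0 | h0 | h0
  · rw [if_neg h0.not_gt, if_pos (neg_pos.2 h0)]
    ring
  · simp [h0]
  · rw [if_pos h0, if_neg (by linarith)]
    ring

theorem sum_sum_eq_zero_of_antisymm {ι : Type*} {F : ι → ι → ℝ} (hF : ∀ i j, F i j = - F j i)
    (A : Finset ι) : ∑ i ∈ A, ∑ j ∈ A, F i j = 0 := by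
  have h : ∑ i ∈ A, ∑ j ∈ A, F i j = - ∑ i ∈ A, ∑ j ∈ A, F i j := by
    nth_rewrite 1 [Finset.sum_comm]
    simp only [← Finset.sum_neg_distrib]
    exact Finset.sum_congr rfl fun i _ => Finset.sum_congr rfl fun j _ => hF j i
  linarith

/-- Discrete integration by parts. -/
theorem sum_mul_sum_of_antisymm {ι : Type*} [Fintype ι] {F : ι → ι → ℝ}
    (hF : ∀ i j, F i j = - F j i) (g : ι → ℝ) :
    ∑ i, g i * ∑ j, F i j = 1 / 2 * ∑ i, ∑ j, (g i - g j) * F i j := by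
  have h : ∑ i, ∑ j, g j * F i j = - ∑ i, ∑ j, g i * F i j := by
    rw [Finset.sum_comm]
    simp only [← Finset.sum_neg_distrib]
    exact Finset.sum_congr rfl fun i _ => Finset.sum_congr rfl fun j _ => by rw [hF j i]; ring
  simp only [sub_mul, Finset.sum_sub_distrib, h, Finset.mul_sum]
  ring

theorem le_upwind {q : Fin N → ℝ} {μ : ℝ} (h : ∀ i, μ ≤ q i) (i j : Fin N) (v : ℝ) :
    μ ≤ upwind q i j v := by
  unfold upwind
  split_ifs
  exacts [h j, h i]

/-- The dissipation of the risk along the flow dominates the Dirichlet energy of its gradient. -/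
theorem mul_dirichlet_le_dissipation (G : WeightedGraph N) (α β : ℝ) (l : Fin N → ℝ)
    {q : Fin N → ℝ} {μ : ℝ} (h : ∀ i, μ ≤ q i) :
    μ * (riskGrad G α β l q ⬝ᵥ (laplacian G).mulVec (riskGrad G α β l q))
      ≤ ∑ i, riskGrad G α β l q i * ∑ j, flowFlux G α β l q i j := by
  rw [sum_mul_sum_of_antisymm (flowFlux_antisymm G α β l q), dotProduct_laplacian_mulVec,
    mul_left_comm]
  refine mul_le_mul_of_nonneg_left ?_ (by norm_num)
  rw [Finset.mul_sum]
  refine Finset.sum_le_sum fun i _ => ?_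
  rw [Finset.mul_sum]
  refine Finset.sum_le_sum fun j _ => ?_
  rw [flowFlux, drive_eq]
  have := mul_le_mul_of_nonneg_left
    (le_upwind h i j (riskGrad G α β l q i - riskGrad G α β l q j))
    (mul_nonneg (G.weight_nonneg i j)
      (sq_nonneg (riskGrad G α β l q i - riskGrad G α β l q j)))
  linarith

/-! ### Lower bound for the densities along the flow -/

theorem exp_potential_sub_le_boltzmannBound (G : WeightedGraph N) (α : ℝ) (l : Fin N → ℝ)
    {q : Fin N → ℝ} (hq : q ∈ stdSimplex ℝ (Fin N)) (i j : Fin N) :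
    Real.exp (potential G α l q i - potential G α l q j) ≤ boltzmannBound G α l := by
  refine le_csSup ?_ ⟨q, hq, i, j, rfl⟩
  have hcont : Continuous fun q : Fin N → ℝ =>
      ∑ i, ∑ j, Real.exp (potential G α l q i - potential G α l q j) :=
    continuous_finsetSum _ fun i _ => continuous_finsetSum _ fun j _ =>
      Real.continuous_exp.comp ((continuous_potential G α l i).sub (continuous_potential G α l j))
  obtain ⟨B, hB⟩ := (isCompact_stdSimplex ℝ (Fin N)).bddAbove_image hcont.continuousOn
  refine ⟨B, ?_⟩
  rintro x ⟨p, hp, i, j, rfl⟩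
  refine le_trans ?_ (hB ⟨p, hp, rfl⟩)
  refine (Finset.single_le_sum (f := fun j => Real.exp (potential G α l p i - potential G α l p j))
    (fun j _ => (Real.exp_pos _).le) (Finset.mem_univ j)).trans ?_
  exact Finset.single_le_sum
    (f := fun i => ∑ j, Real.exp (potential G α l p i - potential G α l p j))
    (fun i _ => Finset.sum_nonneg fun j _ => (Real.exp_pos _).le) (Finset.mem_univ i)

theorem empirical_mem_interiorSimplex (hN : 2 ≤ N) : empirical N ∈ interiorSimplex N := by
  have h : (0 : ℝ) < N := by exact_mod_cast (by omega : 0 < N)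
  have hpos : ∀ i, 0 < empirical N i := fun i => by
    unfold empirical
    positivity
  refine ⟨⟨fun i => (hpos i).le, ?_⟩, hpos⟩
  simp [empirical, h.ne']

theorem boltzmannBound_pos (hN : 2 ≤ N) (G : WeightedGraph N) (α : ℝ) (l : Fin N → ℝ) :
    0 < boltzmannBound G α l :=
  (Real.exp_pos _).trans_le (exp_potential_sub_le_boltzmannBound G α l
    (empirical_mem_interiorSimplex hN).1 ⟨0, by omega⟩ ⟨0, by omega⟩)

/-- Across the boundary of a set that holds almost all the mass, the flow points outwards. -/
theorem drive_neg_of_sum_eq {G : WeightedGraph N} {α β : ℝ} (hβ : 0 < β) {l q : Fin N → ℝ}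
    (hN : 2 ≤ N) (hq : q ∈ interiorSimplex N) {A : Finset (Fin N)} {ε δ : ℝ}
    (hA : ∑ i ∈ A, q i = 1 - ε) (hδ : ∀ i ∈ A, ∑ j ∈ A.erase i, q j ≤ 1 - δ)
    (hε : ε * (1 + (2 * boltzmannBound G α l) ^ (1 / β)) ≤ δ) {i j : Fin N} (hi : i ∈ A)
    (hj : j ∉ A) : drive G α β l q i j < 0 := by
  have hM := boltzmannBound_pos hN G α l
  set M := boltzmannBound G α l
  have hP : 0 < (2 * M) ^ (1 / β) := by positivity
  -- Dropping `i` from `A` loses at least `δ - ε`, while all mass outside `A` totals `ε`. Hence `q i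
  -- / q j ≥ (2M)^{1/β}`, and the entropy part of the drive beats the potential difference by `log
  -- 2`.
  have hqi : δ - ε ≤ q i := by
    have h1 := Finset.add_sum_erase A q hi
    have h2 := hδ i hi
    linarith
  have hqj : q j ≤ ε := by
    have h1 := Finset.sum_le_sum_of_subset_of_nonneg (Finset.subset_univ (insert j A))
      (f := q) fun k _ _ => (hq.2 k).le
    rw [Finset.sum_insert hj, hA, hq.1.2] at h1
    linarith
  have h1 : q j * (2 * M) ^ (1 / β) ≤ q i := by
    have := mul_le_mul_of_nonneg_right hqj hP.le
    linarith
  have h2 := Real.log_le_log (mul_pos (hq.2 j) hP) h1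
  rw [Real.log_mul (hq.2 j).ne' hP.ne', Real.log_rpow (by positivity),
    Real.log_mul two_ne_zero hM.ne'] at h2
  have h3 := mul_le_mul_of_nonneg_left h2 hβ.le
  rw [mul_add, ← mul_assoc, mul_one_div_cancel hβ.ne', one_mul] at h3
  have h4 := exp_potential_sub_le_boltzmannBound G α l hq.1 i j
  rw [← Real.le_log_iff_exp_le hM] at h4
  have h5 := Real.log_pos one_lt_two
  rw [drive_eq, riskGrad, riskGrad]
  linarith

theorem exists_adj_boundary {G : SimpleGraph (Fin N)} (hG : G.Connected) {A : Finset (Fin N)}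
    (hne : A.Nonempty) (huniv : A ≠ Finset.univ) : ∃ i ∈ A, ∃ j, j ∉ A ∧ G.Adj i j := by
  obtain ⟨a, ha⟩ := hne
  obtain ⟨b, hb⟩ : ∃ b, b ∉ A := by
    by_contra! h
    exact huniv (Finset.eq_univ_iff_forall.2 h)
  obtain ⟨p⟩ := hG.preconnected a b
  obtain ⟨d, -, h1, h2⟩ := p.exists_boundary_dart (A : Set (Fin N)) ha hb
  exact ⟨d.fst, h1, d.snd, h2, d.adj⟩

/-- A set that holds almost all the mass loses mass along the flow. -/
theorem sum_flowFlux_neg {G : WeightedGraph N} (hG : G.graph.Connected) {α β : ℝ} (hβ : 0 < β)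
    {l q : Fin N → ℝ} (hN : 2 ≤ N) (hq : q ∈ interiorSimplex N) {A : Finset (Fin N)}
    (hne : A.Nonempty) (huniv : A ≠ Finset.univ) {ε δ : ℝ}
    (hA : ∑ i ∈ A, q i = 1 - ε) (hδ : ∀ i ∈ A, ∑ j ∈ A.erase i, q j ≤ 1 - δ)
    (hε : ε * (1 + (2 * boltzmannBound G α l) ^ (1 / β)) ≤ δ) :
    ∑ i ∈ A, ∑ j, flowFlux G α β l q i j < 0 := by
  have hsplit : ∑ i ∈ A, ∑ j, flowFlux G α β l q i j
      = ∑ i ∈ A, ∑ j ∈ Aᶜ, flowFlux G α β l q i j := by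
    simp only [← Finset.sum_add_sum_compl A, Finset.sum_add_distrib]
    rw [sum_sum_eq_zero_of_antisymm (flowFlux_antisymm G α β l q), zero_add]
  have hdrive : ∀ i ∈ A, ∀ j ∈ Aᶜ,
      drive G α β l q i j * upwind q i j (drive G α β l q i j) < 0 := fun i hi j hj => by
    have h := drive_neg_of_sum_eq hβ hN hq hA hδ hε hi (Finset.mem_compl.1 hj)
    rw [upwind, if_neg h.not_gt]
    exact mul_neg_of_neg_of_pos h (hq.2 i)
  have hle : ∀ i ∈ A, ∀ j ∈ Aᶜ, flowFlux G α β l q i j ≤ 0 := fun i hi j hj =>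
    mul_nonpos_of_nonneg_of_nonpos (G.weight_nonneg i j) (hdrive i hi j hj).le
  obtain ⟨a, ha, b, hb, hab⟩ := exists_adj_boundary hG hne huniv
  rw [hsplit]
  exact Finset.sum_neg' (fun i hi => Finset.sum_nonpos (hle i hi))
    ⟨a, ha, Finset.sum_neg' (hle a ha) ⟨b, Finset.mem_compl.2 hb,
      mul_neg_of_pos_of_neg (G.weight_pos a b hab) (hdrive a ha b (Finset.mem_compl.2 hb))⟩⟩

/-- Barrier argument: at any time when the mass of `A` equals `1 - ε`, its derivative is negative,
so the level cannot be crossed. Initially a vertex outside `A` holds `1 / N ≥ ε`. -/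
theorem IsGradientFlow.sum_le {G : WeightedGraph N} (hG : G.graph.Connected) {α β : ℝ}
    (hβ : 0 < β) {l : Fin N → ℝ} (hN : 2 ≤ N) {T : ℝ} {q : ℝ → Fin N → ℝ}
    (hq : IsGradientFlow G α β l (empirical N) T q) {A : Finset (Fin N)} (hne : A.Nonempty)
    (huniv : A ≠ Finset.univ) {ε δ : ℝ} (hεN : ε ≤ 1 / N)
    (hδ : ∀ t ∈ Set.Icc 0 T, ∀ i ∈ A, ∑ j ∈ A.erase i, q t j ≤ 1 - δ)
    (hε : ε * (1 + (2 * boltzmannBound G α l) ^ (1 / β)) ≤ δ) :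
    ∀ t ∈ Set.Icc 0 T, ∑ i ∈ A, q t i ≤ 1 - ε := by
  have hd : ∀ t ∈ Set.Icc 0 T, HasDerivWithinAt (fun s => ∑ i ∈ A, q s i)
      (∑ i ∈ A, ∑ j, flowFlux G α β l (q t) i j) (Set.Icc 0 T) t := fun t ht =>
    HasDerivWithinAt.fun_sum fun i _ => hq.flow t ht i
  refine image_le_of_deriv_right_lt_deriv_boundary (B := fun _ => 1 - ε) (B' := fun _ => 0)
    (fun t ht => (hd t ht).continuousWithinAt)
    (fun t ht => (hd t (Set.Ico_subset_Icc_self ht)).mono_of_mem_nhdsWithin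
      (Icc_mem_nhdsGE_of_mem ht)) ?_ (fun t => hasDerivAt_const t _) ?_
  · obtain ⟨b, hb⟩ : ∃ b, b ∉ A := by
      by_contra! h
      exact huniv (Finset.eq_univ_iff_forall.2 h)
    have he := empirical_mem_interiorSimplex hN
    have h1 := Finset.sum_le_sum_of_subset_of_nonneg (Finset.subset_univ (insert b A))
      (f := empirical N) fun k _ _ => (he.2 k).le
    rw [Finset.sum_insert hb, he.1.2] at h1
    rw [hq.start]
    have : empirical N b = 1 / N := rfl
    linarith
  · intro t ht h
    have ht' := Set.Ico_subset_Icc_self ht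
    exact sum_flowFlux_neg hG hβ hN (hq.mem t ht') hne huniv h (hδ t ht') hε

/-- All densities stay above `2 m` along the flow. -/
theorem IsGradientFlow.two_mul_mConst_le {G : WeightedGraph N} (hG : G.graph.Connected) {α β : ℝ}
    (hβ : 0 < β) {l : Fin N → ℝ} (hN : 2 ≤ N) {T : ℝ} {q : ℝ → Fin N → ℝ}
    (hq : IsGradientFlow G α β l (empirical N) T q) {t : ℝ} (ht : t ∈ Set.Icc 0 T) (i : Fin N) :
    2 * mConst G α β l ≤ q t i := by
  have hM := boltzmannBound_pos hN G α l
  have hP : 0 < 1 + (2 * boltzmannBound G α l) ^ (1 / β) := by positivity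
  set P := 1 + (2 * boltzmannBound G α l) ^ (1 / β) with hPdef
  have hP1 : 1 ≤ P := by
    have : 0 < (2 * boltzmannBound G α l) ^ (1 / β) := by positivity
    linarith
  have hN0 : (0 : ℝ) < N := by exact_mod_cast (by omega : 0 < N)
  have hc1 : 1 / P ≤ 1 := by rw [div_le_one hP]; exact hP1
  have hmin : 0 < min (1 / P) (1 / (N : ℝ)) := by positivity
  -- Induction on the size of `A`: the bound for `A.erase i` supplies `δ`, and the next `ε` is `δ /
  -- P`. For a singleton the erased set is empty, so `δ = 1`.
  have key : ∀ k : ℕ, ∀ A : Finset (Fin N), A.card = k + 1 → A ≠ Finset.univ →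
      ∀ t ∈ Set.Icc 0 T, ∑ i ∈ A, q t i ≤ 1 - (1 / P) ^ k * min (1 / P) (1 / (N : ℝ)) := by
    intro k
    induction k with
    | zero =>
      intro A hA huniv
      obtain ⟨a, rfl⟩ := Finset.card_eq_one.1 hA
      refine hq.sum_le hG hβ hN (Finset.singleton_nonempty a) huniv (δ := 1) ?_ ?_ ?_
      · simp
      · intro t _ i hi
        rw [Finset.mem_singleton.1 hi]
        simp
      · rw [← hPdef, pow_zero, one_mul, ← le_div_iff₀ hP]
        exact min_le_left _ _
    | succ k ih =>
      intro A hA huniv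
      refine hq.sum_le hG hβ hN (Finset.card_pos.1 (by omega)) huniv
        (δ := (1 / P) ^ k * min (1 / P) (1 / (N : ℝ))) ?_ ?_ ?_
      · exact (mul_le_of_le_one_left hmin.le (pow_le_one₀ (by positivity) hc1)).trans
          (min_le_right _ _)
      · intro t ht i hi
        refine ih _ (by rw [Finset.card_erase_of_mem hi]; omega) (fun h => ?_) t ht
        exact Finset.notMem_erase i A (h ▸ Finset.mem_univ i)
      · rw [← hPdef, pow_succ]
        apply le_of_eq
        field_simp
  -- The complement of `i` has `N - 1 = (N - 2) + 1` vertices.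
  have h := key (N - 2) (Finset.univ.erase i)
    (by rw [Finset.card_erase_of_mem (Finset.mem_univ i), Finset.card_univ, Fintype.card_fin]
        omega)
    (fun h => Finset.notMem_erase i Finset.univ (by rw [h]; exact Finset.mem_univ i)) t ht
  have h1 := Finset.add_sum_erase Finset.univ (q t) (Finset.mem_univ i)
  rw [(hq.mem t ht).1.2] at h1
  rw [mConst, ← hPdef]
  linarith

theorem mConst_pos (hN : 2 ≤ N) (G : WeightedGraph N) (α β : ℝ) (l : Fin N → ℝ) :
    0 < mConst G α β l := by
  have hM := boltzmannBound_pos hN G α l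
  have hN0 : (0 : ℝ) < N := by exact_mod_cast (by omega : 0 < N)
  unfold mConst
  positivity

theorem mConst_le_one (hN : 2 ≤ N) (G : WeightedGraph N) (α β : ℝ) (l : Fin N → ℝ) :
    mConst G α β l ≤ 1 := by
  have hM := boltzmannBound_pos hN G α l
  have hN0 : (0 : ℝ) < N := by exact_mod_cast (by omega : 0 < N)
  have hc0 : 0 ≤ 1 / (1 + (2 * boltzmannBound G α l) ^ (1 / β)) := by positivity
  have hc1 : 1 / (1 + (2 * boltzmannBound G α l) ^ (1 / β)) ≤ 1 := by
    rw [div_le_one (by positivity)]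
    exact le_add_of_nonneg_right (by positivity)
  unfold mConst
  refine mul_le_one₀ (mul_le_one₀ (by norm_num) (by positivity) (pow_le_one₀ hc0 hc1))
    (by positivity) ((min_le_left _ _).trans hc1)

/-! ### Growth of the risk along the flow. -/

theorem IsGradientFlow.hasDerivWithinAt_risk {G : WeightedGraph N} {α β : ℝ} {l : Fin N → ℝ}
    {q₀ : Fin N → ℝ} {T : ℝ} {q : ℝ → Fin N → ℝ} (hq : IsGradientFlow G α β l q₀ T q)
    {t : ℝ} (ht : t ∈ Set.Icc 0 T) :
    HasDerivWithinAt (fun s => risk G α β l (q s))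
      (∑ i, riskGrad G α β l (q t) i * ∑ j, flowFlux G α β l (q t) i j) (Set.Icc 0 T) t :=
  GCDRO.hasDerivWithinAt_risk G α β l (hq.flow t ht) (hq.mem t ht).2

theorem IsGradientFlow.monotoneOn_risk {G : WeightedGraph N} {α β : ℝ} {l : Fin N → ℝ}
    {q₀ : Fin N → ℝ} {T : ℝ} {q : ℝ → Fin N → ℝ} (hq : IsGradientFlow G α β l q₀ T q) :
    MonotoneOn (fun t => risk G α β l (q t)) (Set.Icc 0 T) := by
  refine monotoneOn_of_hasDerivWithinAt_nonneg (convex_Icc 0 T)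
    (fun t ht => (hq.hasDerivWithinAt_risk ht).continuousWithinAt)
    (fun t ht => (hq.hasDerivWithinAt_risk (interior_subset ht)).mono interior_subset)
    (fun t ht => ?_)
  have h := mul_dirichlet_le_dissipation G α β l
    fun i => ((hq.mem t (interior_subset ht)).2 i).le
  rwa [zero_mul] at h

/-- If the initial density is not a maximizer, then the flow strictly increases the risk. -/
theorem IsGradientFlow.risk_lt {G : WeightedGraph N} (hG : G.graph.Connected) {α β : ℝ}
    {l : Fin N → ℝ} {q₀ : Fin N → ℝ} {T : ℝ} (hT : 0 < T) {q : ℝ → Fin N → ℝ}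
    (hq : IsGradientFlow G α β l q₀ T q)
    (hconc : ConcaveOn ℝ (stdSimplex ℝ (Fin N)) (risk G α β l))
    (hne : ¬ IsMaxOn (risk G α β l) (stdSimplex ℝ (Fin N)) q₀) :
    risk G α β l q₀ < risk G α β l (q T) := by
  have h0 : (0 : ℝ) ∈ Set.Icc 0 T := ⟨le_rfl, hT.le⟩
  have hTm : T ∈ Set.Icc 0 T := ⟨hT.le, le_rfl⟩
  have hmono := hq.monotoneOn_risk
  have hs : q 0 = q₀ := hq.start
  rw [← hs] at hne ⊢
  refine lt_of_le_of_ne (hmono h0 hTm hT.le) fun heq => hne ?_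
  have hconst : ∀ t ∈ Set.Icc 0 T, risk G α β l (q t) = risk G α β l (q 0) := fun t ht =>
    le_antisymm ((hmono ht hTm ht.2).trans heq.ge) (hmono h0 ht ht.1)
  -- Equal risks at both ends and monotonicity make the risk constant, so its one-sided derivative
  -- at 0, the initial dissipation, vanishes.
  have hzero := (uniqueDiffOn_Icc hT 0 h0).eq_deriv _ (hq.hasDerivWithinAt_risk h0)
    ((hasDerivWithinAt_const (0 : ℝ) (Set.Icc 0 T) (risk G α β l (q 0))).congr hconst rfl)
  have hq0 := hq.mem 0 h0
  have : Nonempty (Fin N) := hG.nonempty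
  obtain ⟨a, ha⟩ := Finite.exists_min (q 0)
  have hdiss := mul_dirichlet_le_dissipation G α β l ha
  rw [hzero] at hdiss
  have hD := nonpos_of_mul_nonpos_right hdiss (hq0.2 a)
  have hgrad := eq_of_dotProduct_laplacian_nonpos hG hD
  refine isMaxOn_iff.2 fun p hp => (risk_le_of_concaveOn hconc hq0 hp).trans ?_
  rw [Finset.sum_congr rfl fun i _ => by rw [hgrad i a], ← Finset.mul_sum,
    Finset.sum_sub_distrib, hp.2, hq0.1.2, sub_self, mul_zero, add_zero]

/-! ### Polyak–Łojasiewicz inequality and exponential decay. -/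

theorem lambdaSec_mul_variance_le {G : WeightedGraph N} (hG : G.graph.Connected) (hN : 2 ≤ N)
    (x : Fin N → ℝ) :
    ∃ a, lambdaSec G hN * ∑ i, (x i - a) ^ 2 ≤ x ⬝ᵥ (laplacian G).mulVec x := by
  have hN0 : (N : ℝ) ≠ 0 := by exact_mod_cast (by omega : N ≠ 0)
  refine ⟨(∑ i, x i) / N, ?_⟩
  have h := lambdaSec_mul_le hG hN (x := fun i => x i - (∑ i, x i) / N) (by
    rw [Finset.sum_sub_distrib, Finset.sum_const, Finset.card_univ, Fintype.card_fin, nsmul_eq_mul,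
      mul_div_cancel₀ _ hN0, sub_self])
  rw [dotProduct_laplacian_mulVec] at h ⊢
  simp only [sub_sub_sub_cancel_right, dotProduct, ← pow_two] at h
  exact h

/-- Polyak–Łojasiewicz inequality for the risk in the geometric Wasserstein space. -/
theorem mul_gap_le_dissipation {G : WeightedGraph N} (hG : G.graph.Connected) (hN : 2 ≤ N)
    {α β : ℝ} {l q p : Fin N → ℝ} (hpos : 0 < lambdaMin G α β l) (hq : q ∈ interiorSimplex N)
    (hp : p ∈ stdSimplex ℝ (Fin N)) {μ : ℝ} (hμ : 0 ≤ μ) (h : ∀ i, μ ≤ q i) :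
    2 * μ * lambdaSec G hN * lambdaMin G α β l * (risk G α β l p - risk G α β l q)
      ≤ ∑ i, riskGrad G α β l q i * ∑ j, flowFlux G α β l q i j := by
  obtain ⟨a, ha⟩ := lambdaSec_mul_variance_le hG hN (riskGrad G α β l q)
  have h1 := mul_le_mul_of_nonneg_left (risk_sub_le_variance hpos hq hp a)
    (mul_nonneg hμ (lambdaSec_pos hG hN).le)
  have h2 := mul_le_mul_of_nonneg_left ha hμ
  have h3 := mul_dirichlet_le_dissipation G α β l h
  linarith

/-- Exponential decay of the gap to any competitor `p`. -/
theorem IsGradientFlow.gap_le {G : WeightedGraph N} (hG : G.graph.Connected) (hN : 2 ≤ N)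
    {α β : ℝ} {l p q₀ : Fin N → ℝ} (hpos : 0 < lambdaMin G α β l) {T : ℝ} (hT : 0 ≤ T)
    {q : ℝ → Fin N → ℝ} (hq : IsGradientFlow G α β l q₀ T q)
    (hp : p ∈ stdSimplex ℝ (Fin N)) {μ : ℝ} (hμ : 0 ≤ μ)
    (h : ∀ t ∈ Set.Icc 0 T, ∀ i, μ ≤ q t i) :
    risk G α β l p - risk G α β l (q T) ≤ (risk G α β l p - risk G α β l q₀)
      * Real.exp (- (2 * μ * lambdaSec G hN * lambdaMin G α β l) * T) := by
  set K := 2 * μ * lambdaSec G hN * lambdaMin G α β l with hK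
  have hd : ∀ t ∈ Set.Icc 0 T, ∀ S ⊆ Set.Icc 0 T, HasDerivWithinAt
      (fun s => (risk G α β l p - risk G α β l (q s)) * Real.exp (K * s))
      (- (∑ i, riskGrad G α β l (q t) i * ∑ j, flowFlux G α β l (q t) i j) * Real.exp (K * t)
        + (risk G α β l p - risk G α β l (q t)) * (Real.exp (K * t) * K)) S t := by
    intro t ht S hS
    refine (((hq.hasDerivWithinAt_risk ht).mono hS).const_sub _).fun_mul ?_
    simpa using ((hasDerivWithinAt_id t S).const_mul K).exp
  -- Grönwall with an integrating factor; the sign of the gap plays no role, so `p` can be any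
  -- distribution.
  have hanti : AntitoneOn
      (fun s => (risk G α β l p - risk G α β l (q s)) * Real.exp (K * s)) (Set.Icc 0 T) := by
    refine antitoneOn_of_hasDerivWithinAt_nonpos (convex_Icc 0 T)
      (fun t ht => (hd t ht _ subset_rfl).continuousWithinAt)
      (fun t ht => hd t (interior_subset ht) _ interior_subset) (fun t ht => ?_)
    have ht' := interior_subset ht
    have h1 := mul_gap_le_dissipation hG hN hpos (hq.mem t ht') hp hμ (h t ht')
    have h2 := mul_le_mul_of_nonneg_right h1 (Real.exp_pos (K * t)).le
    rw [← hK] at h2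
    linarith
  have h1 := hanti ⟨le_rfl, hT⟩ ⟨hT, le_rfl⟩ hT
  simp only [hq.start, mul_zero, Real.exp_zero, mul_one] at h1
  rw [neg_mul, Real.exp_neg, ← div_eq_mul_inv, le_div_iff₀ (Real.exp_pos _)]
  exact h1

/-! ### Signs and bounds for the rate, and the error ratio. -/

theorem rConst_nonneg {G : WeightedGraph N} (hG : G.graph.Connected) (hN : 2 ≤ N) {α β : ℝ}
    {l : Fin N → ℝ} (hpos : 0 < lambdaMin G α β l) : 0 ≤ rConst G hN α β l := by
  have h1 : 0 ≤ maxWeight G := Real.iSup_nonneg fun e => G.weight_nonneg _ _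
  have h2 : 0 ≤ hessianNorm G α β l := Real.sSup_nonneg (by
    rintro x ⟨q, -, -, j, rfl⟩
    exact Finset.sum_nonneg fun i _ => abs_nonneg _)
  have h3 := lambdaSec_pos hG hN
  have h4 := h3.le.trans (lambdaSec_le_lambdaMax G hN)
  have h5 := sub_nonneg.2 (mConst_le_one hN G α β l)
  unfold rConst
  positivity

theorem rate_pos {G : WeightedGraph N} (hG : G.graph.Connected) (hN : 2 ≤ N) {α β : ℝ}
    {l : Fin N → ℝ} (hpos : 0 < lambdaMin G α β l) : 0 < rate G hN α β l := by
  have h1 := rConst_nonneg hG hN hpos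
  have h2 := mConst_pos hN G α β l
  have h3 := lambdaSec_pos hG hN
  unfold rate
  positivity

theorem rate_le {G : WeightedGraph N} (hG : G.graph.Connected) (hN : 2 ≤ N) {α β : ℝ}
    {l : Fin N → ℝ} (hpos : 0 < lambdaMin G α β l) :
    rate G hN α β l ≤ 2 * mConst G α β l * lambdaSec G hN * lambdaMin G α β l := by
  have h1 := rConst_nonneg hG hN hpos
  have h2 := mConst_pos hN G α β l
  have h3 := lambdaSec_pos hG hN
  refine mul_le_of_le_one_right (by positivity) ?_
  rw [div_le_one (by positivity)]
  exact one_le_pow₀ (by linarith)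

/-- The factor `1 / (r + 1)²` is nonnegative whatever value `r` takes, even when `r + 1 = 0`, so the
sign is that of `lambdaMin`. -/
theorem rate_nonpos {G : WeightedGraph N} (hG : G.graph.Connected) (hN : 2 ≤ N) {α β : ℝ}
    {l : Fin N → ℝ} (h : lambdaMin G α β l ≤ 0) : rate G hN α β l ≤ 0 := by
  have h2 := mConst_pos hN G α β l
  have h3 := lambdaSec_pos hG hN
  exact mul_nonpos_of_nonpos_of_nonneg (mul_nonpos_of_nonneg_of_nonpos (by positivity) h)
    (by positivity)

/-- The approximation error ratio decays strictly faster than `exp (- rate * T)`. -/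
theorem IsGradientFlow.ratio_lt {G : WeightedGraph N} (hG : G.graph.Connected) (hN : 2 ≤ N)
    {α β : ℝ} (hβ : 0 < β) {l p : Fin N → ℝ} {T : ℝ} (hT : 0 < T) {q : ℝ → Fin N → ℝ}
    (hq : IsGradientFlow G α β l (empirical N) T q) (hp : p ∈ stdSimplex ℝ (Fin N))
    (hlt : risk G α β l (empirical N) < risk G α β l (q T))
    (hle : risk G α β l (q T) ≤ risk G α β l p) :
    (risk G α β l p - risk G α β l (q T)) / (risk G α β l p - risk G α β l (empirical N))
      < Real.exp (- rate G hN α β l * T) := by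
  have hgap : 0 < risk G α β l p - risk G α β l (empirical N) := by linarith
  rcases le_or_gt (lambdaMin G α β l) 0 with hneg | hpos
  · have h1 : (1 : ℝ) ≤ Real.exp (- rate G hN α β l * T) :=
      Real.one_le_exp (mul_nonneg (neg_nonneg.2 (rate_nonpos hG hN hneg)) hT.le)
    refine lt_of_lt_of_le ?_ h1
    rw [div_lt_one hgap]
    linarith
  · have hm := mConst_pos hN G α β l
    -- Here `μ = 2 m`, so the decay exponent is twice the upper bound of `rate_le`; this slack gives
    -- strictness.
    have h1 := hq.gap_le hG hN hpos hT.le hp (by positivity)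
      fun t ht => hq.two_mul_mConst_le hG hβ hN ht
    rw [div_lt_iff₀ hgap, mul_comm]
    refine h1.trans_lt (mul_lt_mul_of_pos_left (Real.exp_lt_exp.2 ?_) hgap)
    have h2 := rate_le hG hN hpos
    have h3 := rate_pos hG hN hpos
    exact mul_lt_mul_of_pos_right (by linarith) hT

end GCDRO

theorem proposition3p2
    {Θ X Y Z : Type*} {N : ℕ} (hN : 2 ≤ N)
    (f : Θ → X → Z) (loss : Z → Y → ℝ) (x : Fin N → X) (y : Fin N → Y) (θ : Θ)
    (G : GCDRO.WeightedGraph N) (hG : G.graph.Connected)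
    (α β : ℝ) (hβ : 0 < β)
    (l : Fin N → ℝ) (hl : ∀ i, l i = loss (f θ (x i)) (y i))
    (hconc : ConcaveOn ℝ (stdSimplex ℝ (Fin N)) (GCDRO.risk G α β l))
    (hne : ¬ IsMaxOn (GCDRO.risk G α β l) (stdSimplex ℝ (Fin N)) (GCDRO.empirical N))
    (T : ℝ) (hT : 0 < T)
    (q : ℝ → Fin N → ℝ)
    (hq : GCDRO.IsGradientFlow G α β l (GCDRO.empirical N) T q)
    (qstar : Fin N → ℝ)
    (hmem : qstar ∈ GCDRO.gwBall G (GCDRO.empirical N)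
      (GCDRO.gwSq G (GCDRO.empirical N) (q T)))
    (hmax : IsMaxOn (GCDRO.risk G α β l)
      (GCDRO.gwBall G (GCDRO.empirical N) (GCDRO.gwSq G (GCDRO.empirical N) (q T))) qstar) :
    0 < GCDRO.risk G α β l qstar - GCDRO.risk G α β l (GCDRO.empirical N) ∧
    (GCDRO.risk G α β l qstar - GCDRO.risk G α β l (q T)) /
        (GCDRO.risk G α β l qstar - GCDRO.risk G α β l (GCDRO.empirical N))
      < Real.exp (- GCDRO.rate G hN α β l * T) ∧
    (0 < GCDRO.lambdaMin G α β l → 0 < GCDRO.rate G hN α β l) := by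
  have hlt := hq.risk_lt hG hT hconc hne
  have hle : GCDRO.risk G α β l (q T) ≤ GCDRO.risk G α β l qstar :=
    -- The radius is the squared distance to `q T` itself, so `q T` lies in the ball by reflexivity.
    isMaxOn_iff.1 hmax _ ⟨hq.mem T ⟨hT.le, le_rfl⟩, le_rfl⟩
  exact ⟨by linarith, hq.ratio_lt hG hN hβ hT hmem.1.1 hlt hle,
    GCDRO.rate_pos hG hN⟩
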